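/- **Setting.** An *abstract state space* $(A,\Omega_A,u_A)$ consists of a finite-dimensional real vector space $A$, a convex compact set $\Omega_A\subset A$ of *states* such that $A_+:=\mathbb R_{\ge 0}\cdot\Omega_A$ is a closed, generating cone (a non-empty set closed under addition and nonnegative scaling with $A_+\cap(-A_+)=\{0\}$ and $\operatorname{span}A_+=A$), and a linear functional $u_A\in A^*$ with $u_A(w)>0$ for all $0\ne w\in A_+$ and, for $w\in A_+$, $u_A(w)=1\Leftrightarrow w\in\Omega_A$. The extreme points of $\Omega_A$ are the *pure states*. An *effect* is a linear functional $e\in A^*$ with $0\le e\le u_A$ on $A_+$; for functionals, $e\le f$ means $e(w)\le f(w)$ for all $w\in\Omega_A$. A *transformation* is a linear map $T:A\to A$ with $T(A_+)\subset A_+$ and $u_A\circ T\le u_A$; it is *reversible* if $T^{-1}$ exists and is a transformation. A *generalized probabilistic theory* (GPT) is an abstract state space together with * a convex, closed set $\mathcal E_A$ of *allowed* effects that spans $A^*$ and satisfies: $e\in\mathcal E_A\Rightarrow u_A-e\in\mathcal E_A$; and $e,f\in\mathcal E_A$, $e+f\le u_A\Rightarrow e+f\in\mathcal E_A$; * a group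 $\mathcal G_A$ of reversible transformations (the physically allowed ones) with $e\circ T\in\mathcal E_A$ for all $e\in\mathcal E_A$, $T\in\mathcal G_A$. Sets of states $B_1,\dots,B_n\subset\Omega_A$ are *perfectly distinguishable* if there are allowed effects $e_1,\dots,e_n\in\mathcal E_A$ with $\sum_j e_j\le u_A$ and $e_j(w)=\delta_{jk}$ for all $j,k$ and all $w\in B_k$. States $w_1,\dots,w_n\in\Omega_A$ are perfectly distinguishable if the sets $\{w_1\},\dots,\{w_n\}$ are. * *Postulate 1 (classical decomposability).* Every $w\in\Omega_A$ can be written as $w=\sum_{j=1}^n p_jw_j$ with a probability distribution $p_1,\dots,p_n$ and perfectly distinguishable pure states $w_1,\dots,w_n$. * *Postulate 2 (strong symmetry).* For every $n$, if $w_1,\dots,w_n$ are perfectly distinguishable pure states and $v_1,\dots,v_n$ are perfectly distinguishable pure states, then there is $T\in\mathcal G_A$ with $T(w_j)=v_j$ for all $j$. **Theorem (state discrimination principle).** Consider a GPT which satisfies Postulates 1 and 2. Let $B_1,B_2\subset\Omega_A$ be sets of states that are perfectly distinguishable (from each other), and let $B_3,B_4\subset B_2$ be subsets that are perfectly distinguishable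 from each other. Then $B_1,B_3,B_4$ are perfectly distinguishable. -/

import Mathlib

/-!
Generalized probabilistic theories in finite dimension: abstract state spaces, allowed effects,
reversible transformations, perfect distinguishability, classical decomposability and strong symmetry.

A finite-dimensional real vector space carries a single Hausdorff vector space topology, so the norm
on `A` below only serves to speak of compact and closed sets, and `A →L[ℝ] ℝ` is the full dual.
-/

/-- A cone: non-empty, closed under addition and under nonnegative scaling, and pointed. -/
structure IsCone {A : Type*} [AddCommGroup A] [Module ℝ A] (K : Set A) : Prop where
  nonempty : K.Nonempty
  add_mem : ∀ x ∈ K, ∀ y ∈ K, x + y ∈ K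
  smul_mem : ∀ p : ℝ, 0 ≤ p → ∀ x ∈ K, p • x ∈ K
  pointed : ∀ x, x ∈ K → -x ∈ K → x = 0

/-- The set `ℝ≥0 · Ω` of nonnegative multiples of elements of `Ω`. -/
def nonnegMultiples {A : Type*} [AddCommGroup A] [Module ℝ A] (Ω : Set A) : Set A :=
  {x | ∃ r : ℝ, 0 ≤ r ∧ ∃ w ∈ Ω, x = r • w}

/-- An abstract state space `(A, Ω, u)`. -/
structure AbstractStateSpace (A : Type*) [NormedAddCommGroup A] [NormedSpace ℝ A]
    [FiniteDimensional ℝ A] where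
  /-- the set of (normalized) states -/
  Ω : Set A
  /-- the order unit, which gives the normalization -/
  u : A →L[ℝ] ℝ
  convex_Ω : Convex ℝ Ω
  isCompact_Ω : IsCompact Ω
  isCone : IsCone (nonnegMultiples Ω)
  isClosed_cone : IsClosed (nonnegMultiples Ω)
  generating : Submodule.span ℝ (nonnegMultiples Ω) = ⊤
  u_pos : ∀ w ∈ nonnegMultiples Ω, w ≠ 0 → 0 < u w
  u_eq_one_iff : ∀ w ∈ nonnegMultiples Ω, (u w = 1 ↔ w ∈ Ω)

namespace AbstractStateSpace

variable {A : Type*} [NormedAddCommGroup A] [NormedSpace ℝ A] [FiniteDimensional ℝ A]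

/-- The cone `A₊` of unnormalized states. -/
def cone (S : AbstractStateSpace A) : Set A := nonnegMultiples S.Ω

/-- The order on functionals: pointwise comparison on all states. -/
def FunctionalLE (S : AbstractStateSpace A) (e f : A →L[ℝ] ℝ) : Prop := ∀ w ∈ S.Ω, e w ≤ f w

/-- The set of all (mathematically possible) effects. -/
def effects (S : AbstractStateSpace A) : Set (A →L[ℝ] ℝ) :=
  {e | ∀ w ∈ S.cone, 0 ≤ e w ∧ e w ≤ S.u w}

/-- Pure states: the extreme points of the set of states. -/
def IsPure (S : AbstractStateSpace A) (w : A) : Prop := w ∈ S.Ω.extremePoints ℝ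

/-- A transformation: a linear map which is positive and does not increase the normalization. -/
def IsTransformation (S : AbstractStateSpace A) (T : A →L[ℝ] A) : Prop :=
  (∀ w ∈ S.cone, T w ∈ S.cone) ∧ ∀ w ∈ S.cone, S.u (T w) ≤ S.u w

end AbstractStateSpace

/-- A generalized probabilistic theory: an abstract state space together with its set of physically
allowed effects and its group of physically allowed reversible transformations. -/
structure GPT (A : Type*) [NormedAddCommGroup A] [NormedSpace ℝ A] [FiniteDimensional ℝ A]
    extends AbstractStateSpace A where
  /-- the set of physically allowed effects -/
  allowed : Set (A →L[ℝ] ℝ)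
  allowed_subset : allowed ⊆ toAbstractStateSpace.effects
  allowed_convex : Convex ℝ allowed
  allowed_closed : IsClosed allowed
  /-- the allowed effects have full dimension (they separate states) -/
  allowed_full : Submodule.span ℝ allowed = ⊤
  /-- counter-events are allowed -/
  allowed_compl : ∀ e ∈ allowed, u - e ∈ allowed
  /-- outcomes of a common measurement may be merged -/
  allowed_add : ∀ e ∈ allowed, ∀ f ∈ allowed,
    toAbstractStateSpace.FunctionalLE (e + f) u → e + f ∈ allowed
  /-- the group of physically allowed reversible transformations -/
  rev : Subgroup (A ≃L[ℝ] A)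
  /-- as `rev` is a group, this also says that the inverse of `T` is a transformation -/
  rev_isTransformation : ∀ T ∈ rev, toAbstractStateSpace.IsTransformation (T : A →L[ℝ] A)
  /-- an allowed transformation followed by an allowed effect is an allowed effect -/
  allowed_comp : ∀ e ∈ allowed, ∀ T ∈ rev, e.comp (T : A →L[ℝ] A) ∈ allowed

namespace GPT

variable {A : Type*} [NormedAddCommGroup A] [NormedSpace ℝ A] [FiniteDimensional ℝ A]

/-- Perfect distinguishability of finitely many sets of states `B₁, …, Bₙ`: there are allowed effects
`e₁, …, eₙ` with `∑ eⱼ ≤ u` (so that they can appear in a common measurement) such that `eⱼ` takes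
the constant value `δⱼₖ` on `Bₖ`. -/
def PerfectlyDistinguishableSets (S : GPT A) {n : ℕ} (B : Fin n → Set A) : Prop :=
  ∃ e : Fin n → (A →L[ℝ] ℝ), (∀ j, e j ∈ S.allowed) ∧
    S.FunctionalLE (∑ j, e j) S.u ∧
    ∀ j k, ∀ w ∈ B k, e j w = if j = k then 1 else 0

/-- Perfect distinguishability of finitely many states `w₁, …, wₙ`: there are allowed effects
`e₁, …, eₙ` with `∑ eⱼ ≤ u` (so that they can appear in a common measurement) such that
`eⱼ(wₖ) = δⱼₖ`. -/
def PerfectlyDistinguishable (S : GPT A) {n : ℕ} (w : Fin n → A) : Prop :=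
  (∀ k, w k ∈ S.Ω) ∧ ∃ e : Fin n → (A →L[ℝ] ℝ), (∀ j, e j ∈ S.allowed) ∧
    S.FunctionalLE (∑ j, e j) S.u ∧
    ∀ j k, e j (w k) = if j = k then 1 else 0

/-- Classical decomposability: every state is a convex combination of perfectly distinguishable pure states. -/
def ClassicalDecomposability (S : GPT A) : Prop :=
  ∀ w ∈ S.Ω, ∃ (n : ℕ) (p : Fin n → ℝ) (v : Fin n → A),
    (∀ j, 0 ≤ p j) ∧ ∑ j, p j = 1 ∧ (∀ j, S.IsPure (v j)) ∧ S.PerfectlyDistinguishable v ∧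
      w = ∑ j, p j • v j

/-- Strong symmetry: any two families of `n` perfectly distinguishable pure states are related by a
reversible transformation. -/
def StrongSymmetry (S : GPT A) : Prop :=
  ∀ (n : ℕ) (w v : Fin n → A),
    (∀ j, S.IsPure (w j)) → S.PerfectlyDistinguishable w →
    (∀ j, S.IsPure (v j)) → S.PerfectlyDistinguishable v →
    ∃ T ∈ S.rev, ∀ j, T (w j) = v j

end GPT

/-! The effects separating `B₃` from `B₄` may leave no room for `e 0`, the effect detecting `B₁`.
They are replaced by smaller allowed effects `g₃`, `g₄` with `g₃ + g₄ ≤ e 1`, where `e 1` is certain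
on `B₂`; then `e 0 + g₃ + g₄ ≤ e 0 + e 1 ≤ u`.

The tool is a symmetric bilinear form for which frames are orthonormal, maximal frames sum to `u`,
and every vector is diagonal in some maximal frame (`exists_isSpectralForm`). It comes from an inner
product invariant under the reversible group, corrected by a multiple of `u ⊗ u`; strong symmetry
makes its values on frames constant. For this form each pure state represents an allowed effect
(`pure_mem_allowed`), and orthogonal pure states are distinguishable (`isFrame_of_pairwise`).

A set of states then has a support, a family of orthogonal pure states whose effects sum to 1 on the
set (`exists_support`), and any allowed effect certain on the set dominates that sum
(`sum_le_of_apply_eq_one`). The supports of `B₃` and `B₄` are mutually orthogonal, so `e 1`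
dominates both sums together. -/

/-! ### Fixed points and invariant forms of bounded group actions. -/

/-- A uniformly bounded linear group action on a finite-dimensional space which preserves a non-empty
compact convex set has a fixed point in that set. -/
theorem Representation.exists_fixedPoint_of_bounded {V G : Type*} [NormedAddCommGroup V]
    [NormedSpace ℝ V] [FiniteDimensional ℝ V] [Group G] (ρ : Representation ℝ G V) {C : ℝ}
    (hC : ∀ g x, ‖ρ g x‖ ≤ C * ‖x‖) {K : Set V} (hne : K.Nonempty) (hcomp : IsCompact K)
    (hconv : Convex ℝ K) (hK : ∀ g, ∀ x ∈ K, ρ g x ∈ K) : ∃ x ∈ K, ∀ g, ρ g x = x := by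
  let E : V ≃L[ℝ] EuclideanSpace ℝ (Fin (Module.finrank ℝ V)) := toEuclidean
  let F : EuclideanSpace ℝ (Fin (Module.finrank ℝ V)) →L[ℝ] V := E.symm
  let E' : V →L[ℝ] EuclideanSpace ℝ (Fin (Module.finrank ℝ V)) := E
  obtain ⟨D, hD, hDE⟩ : ∃ D : ℝ, 0 < D ∧ ∀ g x, ‖E (ρ g x)‖ ≤ D * ‖E x‖ := by
    refine ⟨‖E'‖ * (|C| * ‖F‖) + 1, by positivity, fun g x => ?_⟩
    have a1 : ‖E (ρ g x)‖ ≤ ‖E'‖ * ‖ρ g x‖ := E'.le_opNorm _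
    have a2 : ‖x‖ ≤ ‖F‖ * ‖E x‖ := by simpa [F] using F.le_opNorm (E x)
    have a3 : ‖ρ g x‖ ≤ |C| * (‖F‖ * ‖E x‖) :=
      (hC g x).trans ((mul_le_mul_of_nonneg_right (le_abs_self C) (norm_nonneg x)).trans
        (mul_le_mul_of_nonneg_left a2 (abs_nonneg C)))
    have a4 := mul_le_mul_of_nonneg_left a3 (norm_nonneg E')
    nlinarith [norm_nonneg (E x)]
  have hbdd : ∀ x, BddAbove (Set.range fun g => ‖E (ρ g x)‖ ^ 2) := by
    rintro x
    refine ⟨(D * ‖E x‖) ^ 2, ?_⟩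
    rintro _ ⟨g, rfl⟩
    exact pow_le_pow_left₀ (norm_nonneg _) (hDE g x) 2
  -- The largest squared Euclidean norm along the orbit is an invariant function. Its minimiser on
  -- `K` is fixed: otherwise the midpoint of the minimiser and a translate would have a smaller
  -- value.
  let Φ : V → ℝ := fun x => ⨆ g, ‖E (ρ g x)‖ ^ 2
  have hlsc : LowerSemicontinuous Φ := by
    refine lowerSemicontinuous_ciSup hbdd fun g => Continuous.lowerSemicontinuous ?_
    exact ((E.continuous.comp (ρ g).continuous_of_finiteDimensional).norm).pow 2
  obtain ⟨x, hxK, hx⟩ := (hlsc.lowerSemicontinuousOn K).exists_isMinOn hne hcomp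
  refine ⟨x, hxK, fun h => ?_⟩
  by_contra hne
  set y := ρ h x with hy
  have hyK : y ∈ K := hK h x hxK
  have hΦy : Φ y = Φ x := by
    have : ∀ g, ‖E (ρ g y)‖ ^ 2 = ‖E (ρ (Equiv.mulRight h g) x)‖ ^ 2 := fun g => by
      simp [hy, map_mul]
    simp only [Φ, this]
    exact (Equiv.mulRight h).iSup_comp (g := fun g => ‖E (ρ g x)‖ ^ 2)
  set z : V := (1 / 2 : ℝ) • x + (1 / 2 : ℝ) • y with hz
  have hzK : z ∈ K := hconv hxK hyK (by norm_num) (by norm_num) (by norm_num)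
  have hδ : 0 < ‖E (x - y)‖ := by
    rw [norm_pos_iff, Ne, map_eq_zero_iff _ E.injective, sub_eq_zero]
    exact fun e => hne e.symm
  -- The bound applied to `g⁻¹` keeps the orbit of `x - y` uniformly away from 0, so the gain in the
  -- parallelogram law survives the supremum.
  have hlow : ∀ g, ‖E (x - y)‖ ^ 2 / D ^ 2 ≤ ‖E (ρ g (x - y))‖ ^ 2 := fun g => by
    have h1 := hDE g⁻¹ (ρ g (x - y))
    rw [← Module.End.mul_apply, ← map_mul, inv_mul_cancel, map_one, Module.End.one_apply] at h1
    rw [div_le_iff₀ (by positivity), ← mul_pow, mul_comm]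
    exact pow_le_pow_left₀ (norm_nonneg _) h1 2
  have hΦz : Φ z ≤ Φ x - ‖E (x - y)‖ ^ 2 / D ^ 2 / 4 := by
    refine ciSup_le fun g => ?_
    have h1 : ‖E (ρ g x)‖ ^ 2 ≤ Φ x := le_ciSup (hbdd x) g
    have h2 : ‖E (ρ g y)‖ ^ 2 ≤ Φ x := hΦy ▸ le_ciSup (hbdd y) g
    have h3 := parallelogram_law_with_norm ℝ (E (ρ g x)) (E (ρ g y))
    have h4 := hlow g
    simp only [map_sub] at h4 ⊢
    have h5 : E (ρ g z) = (1 / 2 : ℝ) • (E (ρ g x) + E (ρ g y)) := by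
      simp [hz, smul_add]
    rw [h5, norm_smul, mul_pow]
    norm_num
    linarith
  have h6 : Φ x ≤ Φ z := hx hzK
  have : 0 < ‖E (x - y)‖ ^ 2 / D ^ 2 / 4 := by positivity
  linarith

theorem IsClosed.isCompact_of_norm_le {V : Type*} [NormedAddCommGroup V] [NormedSpace ℝ V]
    [FiniteDimensional ℝ V] {K : Set V} (hK : IsClosed K) {R : ℝ} (hR : ∀ x ∈ K, ‖x‖ ≤ R) :
    IsCompact K := by
  have : ProperSpace V := FiniteDimensional.proper ℝ V
  exact (isCompact_closedBall 0 R).of_isClosed_subset hK fun x hx =>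
    mem_closedBall_zero_iff.mpr (hR x hx)

/-- The action of a represented group on continuous bilinear forms. -/
noncomputable def Representation.onBilinear {A G : Type*} [NormedAddCommGroup A] [NormedSpace ℝ A]
    [FiniteDimensional ℝ A] [Group G] (ρ : Representation ℝ G A) :
    Representation ℝ G (A →L[ℝ] A →L[ℝ] ℝ) where
  toFun g :=
    { toFun := fun B => B.bilinearComp (LinearMap.toContinuousLinearMap (ρ g⁻¹))
        (LinearMap.toContinuousLinearMap (ρ g⁻¹))
      map_add' := fun B B' => by ext x y; simp
      map_smul' := fun c B => by ext x y; simp }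
  map_one' := by ext B x y; simp
  map_mul' g h := by ext B x y; simp

theorem Representation.onBilinear_apply {A G : Type*} [NormedAddCommGroup A] [NormedSpace ℝ A]
    [FiniteDimensional ℝ A] [Group G] (ρ : Representation ℝ G A) (g : G)
    (B : A →L[ℝ] A →L[ℝ] ℝ) (x y : A) : ρ.onBilinear g B x y = B (ρ g⁻¹ x) (ρ g⁻¹ y) := rfl

set_option maxHeartbeats 800000 in
/-- A uniformly bounded linear group action on a finite-dimensional space leaves some positive
definite bilinear form invariant. -/
theorem Representation.exists_invariant_posDef {A G : Type*} [NormedAddCommGroup A] [NormedSpace ℝ A]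
    [FiniteDimensional ℝ A] [Group G] (ρ : Representation ℝ G A) {C : ℝ}
    (hC : ∀ g x, ‖ρ g x‖ ≤ C * ‖x‖) :
    ∃ B : A →L[ℝ] A →L[ℝ] ℝ, (∀ g x y, B (ρ g x) (ρ g y) = B x y) ∧ ∀ x, x ≠ 0 → 0 < B x x := by
  let E : A ≃L[ℝ] EuclideanSpace ℝ (Fin (Module.finrank ℝ A)) := toEuclidean
  let E' : A →L[ℝ] EuclideanSpace ℝ (Fin (Module.finrank ℝ A)) := E
  let F : EuclideanSpace ℝ (Fin (Module.finrank ℝ A)) →L[ℝ] A := E.symm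
  let Q₀ : A →L[ℝ] A →L[ℝ] ℝ := (innerSL ℝ).bilinearComp E' E'
  have hQ₀ : ∀ x y, Q₀ x y = inner ℝ (E x) (E y) := fun _ _ => rfl
  have hinv : ∀ g x, ρ g⁻¹ (ρ g x) = x := fun g x => by
    rw [← Module.End.mul_apply, ← map_mul, inv_mul_cancel, map_one, Module.End.one_apply]
  have hC' : ∀ g x, ‖ρ g x‖ ≤ |C| * ‖x‖ := fun g x =>
    (hC g x).trans (mul_le_mul_of_nonneg_right (le_abs_self C) (norm_nonneg x))
  -- A compact convex invariant set around the orbit of `Q₀`: the forms obeying every pointwise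
  -- upper bound that all translates of `Q₀` obey.
  let K : Set (A →L[ℝ] A →L[ℝ] ℝ) := {B | ∀ x y c, (∀ g, Q₀ (ρ g x) (ρ g y) ≤ c) → B x y ≤ c}
  have hev : ∀ x y, Continuous fun B : A →L[ℝ] A →L[ℝ] ℝ => B x y := fun x y => by fun_prop
  have hbound : ∀ B ∈ K, ‖B‖ ≤ ‖Q₀‖ * |C| * |C| := by
    intro B hB
    have key : ∀ x y, B x y ≤ ‖Q₀‖ * |C| * |C| * ‖x‖ * ‖y‖ := fun x y => by
      refine hB x y _ fun g => (le_abs_self _).trans ((Q₀.le_opNorm₂ _ _).trans ?_)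
      calc ‖Q₀‖ * ‖ρ g x‖ * ‖ρ g y‖ ≤ ‖Q₀‖ * (|C| * ‖x‖) * (|C| * ‖y‖) := by
            gcongr <;> exact hC' _ _
        _ = _ := by ring
    refine B.opNorm_le_bound₂ (by positivity) fun x y => ?_
    rw [Real.norm_eq_abs, abs_le]
    refine ⟨?_, key x y⟩
    have := key x (-y)
    rw [map_neg, norm_neg] at this
    linarith
  have hclosed : IsClosed K := by
    have : K = ⋂ x, ⋂ y, ⋂ c, ⋂ (_ : ∀ g, Q₀ (ρ g x) (ρ g y) ≤ c), {B | B x y ≤ c} := by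
      ext B; simp [K]
    rw [this]
    exact isClosed_iInter fun x => isClosed_iInter fun y => isClosed_iInter fun c =>
      isClosed_iInter fun _ => isClosed_le (hev x y) continuous_const
  have hcompact : IsCompact K := 
    IsClosed.isCompact_of_norm_le (V := A →L[ℝ] A →L[ℝ] ℝ) hclosed hbound
  have hconvex : Convex ℝ K := by
    intro B hB B' hB' a b ha hb hab x y c hc
    have h1 := mul_le_mul_of_nonneg_left (hB x y c hc) ha
    have h2 := mul_le_mul_of_nonneg_left (hB' x y c hc) hb
    have h3 : a * c + b * c = c := by rw [← add_mul, hab, one_mul]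
    simp only [add_apply, smul_apply, smul_eq_mul]
    linarith
  have hpres : ∀ g, ∀ B ∈ K, ρ.onBilinear g B ∈ K := by
    intro g B hB x y c hc
    rw [Representation.onBilinear_apply]
    refine hB _ _ c fun h => ?_
    have := hc (h * g⁻¹)
    simpa [map_mul] using this
  have hbdd : ∀ g B, ‖ρ.onBilinear g B‖ ≤ (|C| * |C|) * ‖B‖ := by
    intro g B
    refine ContinuousLinearMap.opNorm_le_bound₂ _ (by positivity) fun x y => ?_
    rw [Representation.onBilinear_apply]
    refine (B.le_opNorm₂ _ _).trans ?_
    calc ‖B‖ * ‖ρ g⁻¹ x‖ * ‖ρ g⁻¹ y‖ ≤ ‖B‖ * (|C| * ‖x‖) * (|C| * ‖y‖) := by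
          gcongr <;> exact hC' _ _
      _ = _ := by ring
  have hne : K.Nonempty := ⟨Q₀, fun x y c hc => by simpa using hc 1⟩
  obtain ⟨B, hBK, hB⟩ := Representation.exists_fixedPoint_of_bounded
    (V := A →L[ℝ] A →L[ℝ] ℝ) ρ.onBilinear hbdd hne hcompact hconvex hpres
  have hBinv : ∀ g x y, B (ρ g x) (ρ g y) = B x y := fun g x y => by
    have := congrArg (fun B' : A →L[ℝ] A →L[ℝ] ℝ => B' (ρ g x) (ρ g y)) (hB g)
    simp only [Representation.onBilinear_apply, hinv] at this
    exact this.symm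
  have hpos : ∀ x, x ≠ 0 → 0 < B x x := by
    intro x hx
    have hx' : 0 < ‖x‖ := norm_pos_iff.mpr hx
    have hlow : ∀ g, ‖x‖ ≤ (|C| * ‖F‖ + 1) * ‖E (ρ g x)‖ := fun g => by
      have h1 := hC' g⁻¹ (ρ g x)
      rw [hinv] at h1
      have h2 : ‖ρ g x‖ ≤ ‖F‖ * ‖E (ρ g x)‖ := by simpa [F] using F.le_opNorm (E (ρ g x))
      have h3 := mul_le_mul_of_nonneg_left h2 (abs_nonneg C)
      nlinarith [norm_nonneg (E (ρ g x))]
    have hD : 0 < |C| * ‖F‖ + 1 := by positivity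
    -- Membership in `K` gives only upper bounds; negating one argument turns the uniform lower
    -- bound on `Q₀ (ρ g x) (ρ g x)` into one of these.
    have h1 := hBK x (-x) (-(‖x‖ / (|C| * ‖F‖ + 1)) ^ 2) fun g => by
      rw [map_neg, map_neg, hQ₀, real_inner_self_eq_norm_sq, neg_le_neg_iff]
      refine pow_le_pow_left₀ (by positivity) ?_ 2
      rw [div_le_iff₀ hD, mul_comm]
      exact hlow g
    rw [map_neg, neg_le_neg_iff] at h1
    exact lt_of_lt_of_le (by positivity) h1
  exact ⟨B, hBinv, hpos⟩

/-- A uniformly bounded linear group action on a finite-dimensional space leaves some inner product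
invariant. -/
theorem Representation.exists_invariant_form {A G : Type*} [NormedAddCommGroup A] [NormedSpace ℝ A]
    [FiniteDimensional ℝ A] [Group G] (ρ : Representation ℝ G A) {C : ℝ}
    (hC : ∀ g x, ‖ρ g x‖ ≤ C * ‖x‖) :
    ∃ Q : A →ₗ[ℝ] A →ₗ[ℝ] ℝ, (∀ x y, Q x y = Q y x) ∧ (∀ g x y, Q (ρ g x) (ρ g y) = Q x y) ∧
      ∀ x, x ≠ 0 → 0 < Q x x := by
  obtain ⟨B, hBinv, hpos⟩ := ρ.exists_invariant_posDef hC
  refine ⟨LinearMap.mk₂ ℝ (fun x y => B x y + B y x) ?_ ?_ ?_ ?_, ?_, ?_, ?_⟩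
  · intro x x' y; simp; ring
  · intro c x y; simp; ring
  · intro x y y'; simp; ring
  · intro c x y; simp; ring
  · intro x y; simp [add_comm]
  · intro g x y; simp [hBinv]
  · intro x hx; simpa using hpos x hx

namespace GPT

variable {A : Type*} [NormedAddCommGroup A] [NormedSpace ℝ A] [FiniteDimensional ℝ A]

/-! ### States and allowed effects -/

theorem mem_cone_of_mem {S : GPT A} {w : A} (hw : w ∈ S.Ω) : w ∈ S.cone :=
  ⟨1, zero_le_one, w, hw, (one_smul ℝ w).symm⟩

theorem u_of_mem {S : GPT A} {w : A} (hw : w ∈ S.Ω) : S.u w = 1 :=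
  (S.u_eq_one_iff w (mem_cone_of_mem hw)).mpr hw

theorem ne_zero_of_mem {S : GPT A} {w : A} (hw : w ∈ S.Ω) : w ≠ 0 := fun h => by
  have := u_of_mem hw
  rw [h, map_zero] at this
  exact zero_ne_one this

theorem Ω_nonempty (S : GPT A) : S.Ω.Nonempty := by
  obtain ⟨_, _, _, w, hw, _⟩ := S.isCone.nonempty
  exact ⟨w, hw⟩

theorem ext_on_cone {M : Type*} [AddCommGroup M] [Module ℝ M] {S : GPT A} {f g : A →ₗ[ℝ] M}
    (h : ∀ w ∈ S.cone, f w = g w) : f = g :=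
  LinearMap.ext_on S.generating h

theorem ext_on_Ω {M : Type*} [AddCommGroup M] [Module ℝ M] {S : GPT A} {f g : A →ₗ[ℝ] M}
    (h : ∀ w ∈ S.Ω, f w = g w) : f = g := by
  refine ext_on_cone (S := S) ?_
  rintro _ ⟨r, -, w, hw, rfl⟩
  rw [map_smul, map_smul, h w hw]

theorem allowed_nonneg {S : GPT A} {e : A →L[ℝ] ℝ} (he : e ∈ S.allowed) {w : A} (hw : w ∈ S.Ω) :
    0 ≤ e w := (S.allowed_subset he w (mem_cone_of_mem hw)).1

theorem allowed_le_u {S : GPT A} {e : A →L[ℝ] ℝ} (he : e ∈ S.allowed) {w : A} (hw : w ∈ S.Ω) :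
    e w ≤ S.u w := (S.allowed_subset he w (mem_cone_of_mem hw)).2

/-- Some effect `e` is allowed because the allowed effects span, and `u = e + (u - e)`. -/
theorem u_mem_allowed (S : GPT A) : S.u ∈ S.allowed := by
  obtain ⟨w, hw⟩ := S.Ω_nonempty
  have hne : S.allowed.Nonempty := by
    by_contra h
    have h0 : (⊥ : Submodule ℝ (A →L[ℝ] ℝ)) = ⊤ := by
      rw [← S.allowed_full, Set.not_nonempty_iff_eq_empty.mp h, Submodule.span_empty]
    have h1 : S.u ∈ (⊥ : Submodule ℝ (A →L[ℝ] ℝ)) := h0 ▸ Submodule.mem_top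
    have h2 := u_of_mem hw
    rw [(Submodule.mem_bot ℝ).mp h1] at h2
    simp at h2
  obtain ⟨e, he⟩ := hne
  have h := S.allowed_add e he _ (S.allowed_compl e he) fun w _ => by simp
  simpa using h

theorem sum_mem_allowed {S : GPT A} {ι : Type*} (s : Finset ι) {e : ι → A →L[ℝ] ℝ}
    (he : ∀ i ∈ s, e i ∈ S.allowed) (hle : ∀ w ∈ S.Ω, ∑ i ∈ s, e i w ≤ S.u w) :
    ∑ i ∈ s, e i ∈ S.allowed := by
  classical
  induction s using Finset.induction_on with
  | empty => simpa using S.allowed_compl _ S.u_mem_allowed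
  | insert a s ha ih =>
    rw [Finset.sum_insert ha]
    refine S.allowed_add _ (he a (Finset.mem_insert_self a s)) _
      (ih (fun i hi => he i (Finset.mem_insert_of_mem hi)) fun w hw => ?_) fun w hw => ?_
    · have := hle w hw
      rw [Finset.sum_insert ha] at this
      have h1 := allowed_nonneg (he a (Finset.mem_insert_self a s)) hw
      linarith
    · have := hle w hw
      rw [Finset.sum_insert ha] at this
      simpa using this

/-! ### Reversible transformations -/

/-- Neither `T` nor its inverse increases `u` on the cone, and the cone spans. -/
theorem rev_u {S : GPT A} {T : A ≃L[ℝ] A} (hT : T ∈ S.rev) (x : A) : S.u (T x) = S.u x := by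
  have key : (S.u : A →ₗ[ℝ] ℝ) ∘ₗ (T : A →ₗ[ℝ] A) = (S.u : A →ₗ[ℝ] ℝ) := by
    refine ext_on_cone (S := S) fun w hw => le_antisymm ((S.rev_isTransformation T hT).2 w hw) ?_
    have h1 : T w ∈ S.cone := (S.rev_isTransformation T hT).1 w hw
    have h2 := (S.rev_isTransformation T⁻¹ (S.rev.inv_mem hT)).2 _ h1
    have h3 : T⁻¹ (T w) = w := T.symm_apply_apply w
    simpa [h3] using h2
  exact LinearMap.congr_fun key x

theorem rev_mem_Ω {S : GPT A} {T : A ≃L[ℝ] A} (hT : T ∈ S.rev) {w : A} (hw : w ∈ S.Ω) :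
    T w ∈ S.Ω := by
  have h1 : T w ∈ S.cone := (S.rev_isTransformation T hT).1 w (mem_cone_of_mem hw)
  exact (S.u_eq_one_iff _ h1).mp ((rev_u hT w).trans (u_of_mem hw))

theorem rev_isPure {S : GPT A} {T : A ≃L[ℝ] A} (hT : T ∈ S.rev) {w : A} (hw : S.IsPure w) :
    S.IsPure (T w) := by
  have himage : T '' S.Ω = S.Ω := by
    refine Set.Subset.antisymm ?_ fun w hw => ?_
    · rintro _ ⟨w, hw, rfl⟩
      exact rev_mem_Ω hT hw
    · exact ⟨T⁻¹ w, rev_mem_Ω (S.rev.inv_mem hT) hw, T.apply_symm_apply w⟩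
  have := Set.mem_image_of_mem T hw
  rw [image_extremePoints, himage] at this
  exact this

/-- The allowed reversible transformations as a group representation. -/
def revRep (S : GPT A) : Representation ℝ S.rev A where
  toFun T := ((T : A ≃L[ℝ] A) : A →ₗ[ℝ] A)
  map_one' := rfl
  map_mul' _ _ := rfl

/-- States contain a basis, and its images under the group stay in the bounded set `Ω`. -/
theorem exists_revRep_bound (S : GPT A) : ∃ C : ℝ, ∀ T x, ‖S.revRep T x‖ ≤ C * ‖x‖ := by
  obtain ⟨R, hR⟩ := S.isCompact_Ω.isBounded.exists_norm_le
  have hspan : ⊤ ≤ Submodule.span ℝ S.Ω := by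
    rw [← S.generating, Submodule.span_le]
    rintro _ ⟨r, -, w, hw, rfl⟩
    exact Submodule.smul_mem _ _ (Submodule.subset_span hw)
  let b := Module.Basis.ofSpan hspan
  have hb : ∀ i, b i ∈ S.Ω := fun i => Module.Basis.ofSpan_subset hspan ⟨i, rfl⟩
  have := FiniteDimensional.fintypeBasisIndex b
  refine ⟨∑ i, ‖LinearMap.toContinuousLinearMap (b.coord i)‖ * R, fun T x => ?_⟩
  rw [← b.sum_repr x, map_sum, b.sum_repr x, Finset.sum_mul]
  refine (norm_sum_le _ _).trans (Finset.sum_le_sum fun i _ => ?_)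
  rw [map_smul, norm_smul, mul_right_comm]
  exact mul_le_mul ((LinearMap.toContinuousLinearMap (b.coord i)).le_opNorm x)
    (hR _ (rev_mem_Ω T.2 (hb i))) (norm_nonneg _) (by positivity)

theorem exists_invariant_state (S : GPT A) : ∃ μ ∈ S.Ω, ∀ T ∈ S.rev, T μ = μ := by
  obtain ⟨C, hC⟩ := S.exists_revRep_bound
  obtain ⟨μ, hμ, h⟩ := S.revRep.exists_fixedPoint_of_bounded hC S.Ω_nonempty S.isCompact_Ω
    S.convex_Ω fun T w hw => rev_mem_Ω T.2 hw
  exact ⟨μ, hμ, fun T hT => h ⟨T, hT⟩⟩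

/-! ### Families of perfectly distinguishable pure states -/

/-- A frame: a family of perfectly distinguishable pure states. -/
def IsFrame (S : GPT A) {n : ℕ} (w : Fin n → A) : Prop :=
  (∀ j, S.IsPure (w j)) ∧ S.PerfectlyDistinguishable w

theorem isFrame_singleton {S : GPT A} {w : A} (hw : S.IsPure w) :
    S.IsFrame fun _ : Fin 1 => w := by
  refine ⟨fun _ => hw, fun _ => hw.1, fun _ => S.u, fun _ => S.u_mem_allowed, fun w _ => by simp,
    fun j k => ?_⟩
  rw [u_of_mem hw.1, if_pos (Subsingleton.elim j k)]

theorem IsFrame.comp {S : GPT A} {n m : ℕ} {w : Fin n → A} (hw : S.IsFrame w) {f : Fin m → Fin n}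
    (hf : Function.Injective f) : S.IsFrame (w ∘ f) := by
  obtain ⟨hpure, hΩ, e, he, hle, hδ⟩ := hw
  refine ⟨fun j => hpure _, fun j => hΩ _, e ∘ f, fun j => he _, fun x hx => ?_, fun j k => ?_⟩
  · refine le_trans ?_ (hle x hx)
    simp only [sum_apply, Function.comp_apply]
    rw [← Finset.sum_image (f := fun i => e i x) (s := Finset.univ) (g := f) hf.injOn]
    exact Finset.sum_le_sum_of_subset_of_nonneg (Finset.subset_univ _) fun i _ _ =>
      allowed_nonneg (he i) hx
  · simp [hδ, hf.eq_iff]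

theorem IsFrame.map {S : GPT A} {n : ℕ} {w : Fin n → A} (hw : S.IsFrame w) {T : A ≃L[ℝ] A}
    (hT : T ∈ S.rev) : S.IsFrame fun j => T (w j) := by
  obtain ⟨hpure, hΩ, e, he, hle, hδ⟩ := hw
  refine ⟨fun j => rev_isPure hT (hpure j), fun j => rev_mem_Ω hT (hΩ j),
    fun j => (e j).comp ((T⁻¹ : A ≃L[ℝ] A) : A →L[ℝ] A),
    fun j => S.allowed_comp _ (he j) _ (S.rev.inv_mem hT), fun x hx => ?_, fun j k => ?_⟩
  · have h1 := hle _ (rev_mem_Ω (S.rev.inv_mem hT) hx)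
    rw [rev_u (S.rev.inv_mem hT)] at h1
    simpa using h1
  · have h3 : T⁻¹ (T (w k)) = w k := T.symm_apply_apply _
    simpa [h3] using hδ j k

theorem IsFrame.linearIndependent {S : GPT A} {n : ℕ} {w : Fin n → A} (hw : S.IsFrame w) :
    LinearIndependent ℝ w := by
  obtain ⟨-, -, e, -, -, hδ⟩ := hw
  rw [Fintype.linearIndependent_iff]
  intro g hg i
  have := congrArg (e i) hg
  simpa [hδ] using this

theorem IsFrame.exists_map {S : GPT A} (h2 : S.StrongSymmetry) {n : ℕ} {w v : Fin n → A}
    (hw : S.IsFrame w) (hv : S.IsFrame v) : ∃ T ∈ S.rev, ∀ j, T (w j) = v j :=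
  h2 n w v hw.1 hw.2 hv.1 hv.2

theorem exists_isFrame_decomposition {S : GPT A} (h1 : S.ClassicalDecomposability) {w : A}
    (hw : w ∈ S.Ω) : ∃ (n : ℕ) (p : Fin n → ℝ) (v : Fin n → A), S.IsFrame v ∧ (∀ j, 0 ≤ p j) ∧
      ∑ j, p j = 1 ∧ w = ∑ j, p j • v j := by
  obtain ⟨n, p, v, hp, hsum, hpure, hdist, h⟩ := h1 w hw
  exact ⟨n, p, v, ⟨hpure, hdist⟩, hp, hsum, h⟩

theorem exists_isPure {S : GPT A} (h1 : S.ClassicalDecomposability) : ∃ w, S.IsPure w := by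
  obtain ⟨w, hw⟩ := S.Ω_nonempty
  obtain ⟨n, p, v, hv, -, hsum, -⟩ := exists_isFrame_decomposition h1 hw
  cases n with
  | zero => simp at hsum
  | succ n => exact ⟨v 0, hv.1 0⟩

/-- There is a frame size `N` such that every frame extends to a frame of size `N`. -/
theorem exists_frame_extension {S : GPT A} (h2 : S.StrongSymmetry) :
    ∃ N : ℕ, ∀ (n : ℕ) (w : Fin n → A), S.IsFrame w →
      ∃ (h : n ≤ N) (x : Fin N → A), S.IsFrame x ∧ ∀ j, x (Fin.castLE h j) = w j := by
  classical
  let P : ℕ → Prop := fun n => ∃ w : Fin n → A, S.IsFrame w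
  have hbound : ∀ n, P n → n ≤ Module.finrank ℝ A := by
    rintro n ⟨w, hw⟩
    simpa using hw.linearIndependent.fintype_card_le_finrank
  have h0 : P 0 := ⟨Fin.elim0, fun j => j.elim0, fun j => j.elim0, Fin.elim0, fun j => j.elim0,
    fun w hw => by simp [u_of_mem hw], fun j => j.elim0⟩
  obtain ⟨y, hy⟩ := Nat.findGreatest_spec (P := P) (Nat.zero_le (Module.finrank ℝ A)) h0
  refine ⟨Nat.findGreatest P (Module.finrank ℝ A), fun n w hw => ?_⟩
  have hn := Nat.le_findGreatest (P := P) (hbound n ⟨w, hw⟩) ⟨w, hw⟩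
  -- Strong symmetry carries an initial segment of a frame of largest size onto `w`; the rest of the
  -- moved frame is the extension.
  obtain ⟨T, hT, h⟩ := (hy.comp (Fin.castLE_injective hn)).exists_map h2 hw
  exact ⟨hn, _, hy.map hT, h⟩

/-- Every frame extends to a frame of size `N`. -/
def IsMaxFrameSize (S : GPT A) (N : ℕ) : Prop :=
  ∀ (n : ℕ) (w : Fin n → A), S.IsFrame w →
    ∃ (h : n ≤ N) (x : Fin N → A), S.IsFrame x ∧ ∀ j, x (Fin.castLE h j) = w j

theorem IsMaxFrameSize.exists_decomposition {S : GPT A} {N : ℕ} (hN : S.IsMaxFrameSize N)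
    (h1 : S.ClassicalDecomposability) {w : A} (hw : w ∈ S.Ω) :
    ∃ (x : Fin N → A) (q : Fin N → ℝ), S.IsFrame x ∧ (∀ j, 0 ≤ q j) ∧ ∑ j, q j = 1 ∧
      w = ∑ j, q j • x j := by
  obtain ⟨n, p, v, hv, hp, hsum, rfl⟩ := exists_isFrame_decomposition h1 hw
  obtain ⟨h, x, hx, hxv⟩ := hN n v hv
  refine ⟨x, fun i => ∑ j, if Fin.castLE h j = i then p j else 0, hx,
    fun i => Finset.sum_nonneg fun j _ => ?_, ?_, ?_⟩
  · split_ifs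
    exacts [hp j, le_rfl]
  · rw [Finset.sum_comm]
    simpa using hsum
  · simp only [Finset.sum_smul, ite_smul, zero_smul]
    rw [Finset.sum_comm]
    simp [hxv]

theorem IsMaxFrameSize.pos {S : GPT A} {N : ℕ} (hN : S.IsMaxFrameSize N)
    (h1 : S.ClassicalDecomposability) : 0 < N := by
  obtain ⟨w, hw⟩ := exists_isPure h1
  exact (hN 1 _ (isFrame_singleton hw)).1

theorem ext_on_pure {S : GPT A} (h1 : S.ClassicalDecomposability) {f g : A →ₗ[ℝ] ℝ}
    (h : ∀ w, S.IsPure w → f w = g w) : f = g := by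
  refine ext_on_Ω (S := S) fun w hw => ?_
  obtain ⟨n, p, v, hv, -, -, rfl⟩ := exists_isFrame_decomposition h1 hw
  simp [h _ (hv.1 _)]

/-- An invariant state is the uniform mixture of every maximal frame. -/
theorem IsMaxFrameSize.sum_eq {S : GPT A} {N : ℕ} (hN : S.IsMaxFrameSize N)
    (h1 : S.ClassicalDecomposability) (h2 : S.StrongSymmetry) {μ : A} (hμ : μ ∈ S.Ω)
    (hinv : ∀ T ∈ S.rev, T μ = μ) {y : Fin N → A} (hy : S.IsFrame y) :
    ∑ j, y j = (N : ℝ) • μ := by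
  obtain ⟨x, q, hx, -, hsum, hdec⟩ := hN.exists_decomposition h1 hμ
  -- A transposition of the frame is realised by a reversible map. It fixes `μ`, so linear
  -- independence forces equal weights.
  have hq : ∀ i k, q i = q k := by
    intro i k
    obtain ⟨T, hT, h⟩ := hx.exists_map h2 (hx.comp (Equiv.swap i k).injective)
    have e1 : ∑ j, (q j - q (Equiv.swap i k j)) • x j = 0 := by
      have e2 : μ = ∑ j, q (Equiv.swap i k j) • x j := by
        rw [← Equiv.sum_comp (Equiv.swap i k) (fun j => q (Equiv.swap i k j) • x j)]
        calc μ = T μ := (hinv T hT).symm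
          _ = _ := by rw [hdec]; simp [h]
      simp only [sub_smul, Finset.sum_sub_distrib]
      rw [← hdec, ← e2, sub_self]
    have e3 := Fintype.linearIndependent_iff.mp hx.linearIndependent _ e1 i
    simpa [sub_eq_zero] using e3
  have hNq : ∀ i, (N : ℝ) * q i = 1 := fun i => by
    rw [← hsum, Finset.sum_congr rfl fun j _ => hq j i]
    simp
  have hxμ : ∑ j, x j = (N : ℝ) • μ := by
    rw [hdec, Finset.smul_sum]
    exact Finset.sum_congr rfl fun j _ => by rw [smul_smul, hNq, one_smul]
  obtain ⟨T, hT, h⟩ := hx.exists_map h2 hy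
  calc ∑ j, y j = T (∑ j, x j) := by simp [h]
    _ = _ := by rw [hxμ, map_smul, hinv T hT]

theorem sum_mem_cone {S : GPT A} {ι : Type*} (s : Finset ι) {x : ι → A}
    (hx : ∀ i ∈ s, x i ∈ S.cone) : ∑ i ∈ s, x i ∈ S.cone := by
  classical
  induction s using Finset.induction_on with
  | empty =>
    obtain ⟨w, hw⟩ := S.Ω_nonempty
    exact ⟨0, le_rfl, w, hw, by simp⟩
  | insert a s ha ih =>
    rw [Finset.sum_insert ha]
    exact S.isCone.add_mem _ (hx a (Finset.mem_insert_self a s)) _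
      (ih fun i hi => hx i (Finset.mem_insert_of_mem hi))

/-- Every vector is a linear combination of a maximal frame. -/
theorem IsMaxFrameSize.exists_spectral {S : GPT A} {N : ℕ} (hN : S.IsMaxFrameSize N)
    (h1 : S.ClassicalDecomposability) {μ : A} (hμ : μ ∈ S.Ω)
    (hsum : ∀ y : Fin N → A, S.IsFrame y → ∑ j, y j = (N : ℝ) • μ) (z : A) :
    ∃ (x : Fin N → A) (l : Fin N → ℝ), S.IsFrame x ∧ z = ∑ j, l j • x j := by
  -- A large multiple of `μ` moves `z` into the cone, where it is diagonal in a maximal frame;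
  -- subtracting the multiple again keeps it diagonal, as `μ` is uniform over that frame. Both signs
  -- are carried for the sake of negative scalars.
  have hdom : ∃ c : ℝ, c • μ + z ∈ S.cone ∧ c • μ - z ∈ S.cone := by
    have hz : z ∈ Submodule.span ℝ (nonnegMultiples S.Ω) := S.generating ▸ Submodule.mem_top
    induction hz using Submodule.span_induction with
    | mem w hw =>
      obtain ⟨r, hr, w, hwΩ, rfl⟩ := hw
      obtain ⟨x, q, hx, hq, hqs, rfl⟩ := hN.exists_decomposition h1 hwΩ
      refine ⟨r * N, S.isCone.add_mem _ ?_ _ ⟨r, hr, _, hwΩ, rfl⟩, ?_⟩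
      · exact ⟨r * N, by positivity, μ, hμ, rfl⟩
      · have : (r * N) • μ - r • ∑ j, q j • x j = ∑ j, (r * (1 - q j)) • x j := by
          simp only [mul_sub, sub_smul, Finset.sum_sub_distrib, mul_one, mul_smul]
          rw [← Finset.smul_sum, ← Finset.smul_sum, hsum x hx]
        rw [this]
        refine sum_mem_cone _ fun j _ => ⟨_, mul_nonneg hr (sub_nonneg.mpr ?_), _, (hx.1 j).1, rfl⟩
        rw [← hqs]
        exact Finset.single_le_sum (fun i _ => hq i) (Finset.mem_univ j)
    | zero => exact ⟨1, by simpa using mem_cone_of_mem hμ, by simpa using mem_cone_of_mem hμ⟩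
    | add a b _ _ iha ihb =>
      obtain ⟨c, h3, h4⟩ := iha
      obtain ⟨d, h5, h6⟩ := ihb
      refine ⟨c + d, ?_, ?_⟩
      · exact Set.mem_of_eq_of_mem (by module) (S.isCone.add_mem _ h3 _ h5)
      · exact Set.mem_of_eq_of_mem (by module) (S.isCone.add_mem _ h4 _ h6)
    | smul t a _ ih =>
      obtain ⟨c, h3, h4⟩ := ih
      rcases le_total 0 t with ht | ht
      · refine ⟨t * c, ?_, ?_⟩
        · exact Set.mem_of_eq_of_mem (by module) (S.isCone.smul_mem t ht _ h3)
        · exact Set.mem_of_eq_of_mem (by module) (S.isCone.smul_mem t ht _ h4)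
      · refine ⟨-t * c, ?_, ?_⟩
        · exact Set.mem_of_eq_of_mem (by module) (S.isCone.smul_mem (-t) (neg_nonneg.mpr ht) _ h4)
        · exact Set.mem_of_eq_of_mem (by module) (S.isCone.smul_mem (-t) (neg_nonneg.mpr ht) _ h3)
  obtain ⟨c, ⟨r, -, w, hw, hrw⟩, -⟩ := hdom
  obtain ⟨x, q, hx, -, -, rfl⟩ := hN.exists_decomposition h1 hw
  have hN0 : (N : ℝ) ≠ 0 := by exact_mod_cast (hN.pos h1).ne'
  have hμx : μ = (N : ℝ)⁻¹ • ∑ j, x j := by rw [hsum x hx, smul_smul, inv_mul_cancel₀ hN0, one_smul]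
  refine ⟨x, fun j => r * q j - c * (N : ℝ)⁻¹, hx, ?_⟩
  rw [← eq_sub_iff_add_eq'] at hrw
  rw [hrw, hμx]
  simp only [sub_smul, Finset.sum_sub_distrib, mul_smul, Finset.smul_sum]

/-! ### The spectral form. -/

/-- A symmetric bilinear form for which frames are orthonormal, maximal frames resolve the order
unit, and every vector is a combination of a maximal frame. -/
structure IsSpectralForm (S : GPT A) (N : ℕ) (B : A →ₗ[ℝ] A →ₗ[ℝ] ℝ) : Prop where
  symm : ∀ x y, B x y = B y x
  maxFrame : S.IsMaxFrameSize N
  frame : ∀ {n : ℕ} {w : Fin n → A}, S.IsFrame w → ∀ i j, B (w i) (w j) = if i = j then 1 else 0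
  sum_eq_u : ∀ {x : Fin N → A}, S.IsFrame x → ∀ y, ∑ j, B (x j) y = S.u y
  spectral : ∀ z, ∃ (x : Fin N → A) (l : Fin N → ℝ), S.IsFrame x ∧ z = ∑ j, l j • x j

/-- The invariant inner product takes one value `a` on the diagonal at pure states and one value `c
< a` on distinguishable pairs. Subtracting `c` times `u ⊗ u` and dividing by `a - c` makes frames
orthonormal. -/
theorem exists_isSpectralForm {S : GPT A} (h1 : S.ClassicalDecomposability)
    (h2 : S.StrongSymmetry) : ∃ N B, S.IsSpectralForm N B := by
  obtain ⟨N, hN⟩ : ∃ N, S.IsMaxFrameSize N := exists_frame_extension h2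
  obtain ⟨μ, hμ, hinv⟩ := S.exists_invariant_state
  have hsum := fun y : Fin N → A => hN.sum_eq h1 h2 hμ hinv (y := y)
  obtain ⟨C, hC⟩ := S.exists_revRep_bound
  obtain ⟨Q, hQs, hQi, hQp⟩ := S.revRep.exists_invariant_form hC
  replace hQi : ∀ T ∈ S.rev, ∀ x y, Q (T x) (T y) = Q x y := fun T hT => hQi ⟨T, hT⟩
  obtain ⟨w₀, hw₀⟩ := exists_isPure h1
  set a := Q w₀ w₀ with ha
  have htrans : ∀ w, S.IsPure w → ∃ T ∈ S.rev, T w₀ = w := fun w hw => by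
    obtain ⟨T, hT, h⟩ := (isFrame_singleton hw₀).exists_map h2 (isFrame_singleton hw)
    exact ⟨T, hT, h 0⟩
  have hdiag : ∀ w, S.IsPure w → Q w w = a := fun w hw => by
    obtain ⟨T, hT, rfl⟩ := htrans w hw
    exact hQi T hT _ _
  obtain ⟨c, hca, hc⟩ : ∃ c < a, ∀ (n : ℕ) (w : Fin n → A), S.IsFrame w → ∀ i j, i ≠ j →
      Q (w i) (w j) = c := by
    have hpair : ∀ {n : ℕ} {w : Fin n → A}, S.IsFrame w → ∀ {i j}, i ≠ j →
        S.IsFrame (w ∘ ![i, j]) := fun hw i j hij => hw.comp <| by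
      intro k l hkl
      fin_cases k <;> fin_cases l <;> simp_all
    by_cases hex : ∃ v : Fin 2 → A, S.IsFrame v
    · obtain ⟨v, hv⟩ := hex
      refine ⟨Q (v 0) (v 1), ?_, fun n w hw i j hij => ?_⟩
      · have hne : v 0 - v 1 ≠ 0 := by
          rw [sub_ne_zero]
          exact fun h => zero_ne_one (hv.linearIndependent.injective h)
        have := hQp _ hne
        simp only [map_sub, LinearMap.sub_apply, hdiag _ (hv.1 _), hQs (v 1) (v 0)] at this
        linarith
      · obtain ⟨T, hT, h⟩ := hv.exists_map h2 (hpair hw hij)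
        have := hQi T hT (v 0) (v 1)
        rw [h, h] at this
        simpa using this
    -- Without a frame of two states the condition on `c` is vacuous, and 0 serves.
    · exact ⟨0, hQp _ (ne_zero_of_mem hw₀.1), fun n w hw i j hij => (hex ⟨_, hpair hw hij⟩).elim⟩
  have hac : a - c ≠ 0 := (sub_pos.mpr hca).ne'
  let B : A →ₗ[ℝ] A →ₗ[ℝ] ℝ := (a - c)⁻¹ •
    (Q - c • ((S.u : A →ₗ[ℝ] ℝ).smulRight (S.u : A →ₗ[ℝ] ℝ)))
  have hB : ∀ x y, B x y = (a - c)⁻¹ * (Q x y - c * (S.u x * S.u y)) := fun x y => by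
    simp [B]
  have hframe : ∀ {n : ℕ} {w : Fin n → A}, S.IsFrame w → ∀ i j,
      B (w i) (w j) = if i = j then 1 else 0 := fun {n w} hw i j => by
    rw [hB, u_of_mem (hw.1 i).1, u_of_mem (hw.1 j).1]
    split_ifs with h
    · rw [h, hdiag _ (hw.1 j), mul_one, mul_one, inv_mul_cancel₀ hac]
    · rw [hc n w hw i j h]
      ring
  have hBi : ∀ T ∈ S.rev, ∀ x y, B (T x) (T y) = B x y := fun T hT x y => by
    rw [hB, hB, hQi T hT, rev_u hT, rev_u hT]
  refine ⟨N, B, fun x y => ?_, hN, hframe, fun {x} hx y => ?_,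
    hN.exists_spectral h1 hμ hsum⟩
  · rw [hB, hB, hQs, mul_comm (S.u x)]
  -- The sum of the frame is a multiple of `μ`, so the functional it represents is invariant, hence
  -- constant on pure states by transitivity; orthonormality gives the constant 1.
  · have key : B (∑ j, x j) = (S.u : A →ₗ[ℝ] ℝ) := by
      refine ext_on_pure h1 fun w hw => ?_
      let i₀ : Fin N := ⟨0, hN.pos h1⟩
      obtain ⟨T, hT, h⟩ := (isFrame_singleton (hx.1 i₀)).exists_map h2 (isFrame_singleton hw)
      have hTsum : T (∑ j, x j) = ∑ j, x j := by rw [hsum x hx, map_smul, hinv T hT]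
      have h3 : B (∑ j, x j) w = B (∑ j, x j) (x i₀) := by
        rw [← hBi T hT _ (x i₀), hTsum, h 0]
      rw [h3, ContinuousLinearMap.coe_coe, u_of_mem hw.1, map_sum, LinearMap.sum_apply]
      simp [hframe hx]
    simpa using LinearMap.congr_fun key y

/-! ### Effects represented by pure states, and supports of sets of states. -/

namespace IsSpectralForm

variable {S : GPT A} {N : ℕ} {B : A →ₗ[ℝ] A →ₗ[ℝ] ℝ}

theorem apply_sum_frame (hB : S.IsSpectralForm N B) {n : ℕ} {x : Fin n → A} (hx : S.IsFrame x)
    (l : Fin n → ℝ) (i : Fin n) : B (∑ j, l j • x j) (x i) = l i := by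
  simp [hB.frame hx]

theorem exists_representation (hB : S.IsSpectralForm N B) (f : A →ₗ[ℝ] ℝ) : ∃ z, B z = f := by
  have hinj : Function.Injective B := by
    rw [← LinearMap.ker_eq_bot, LinearMap.ker_eq_bot']
    intro z hz
    obtain ⟨x, l, hx, rfl⟩ := hB.spectral z
    have hl : ∀ i, l i = 0 := fun i => by rw [← hB.apply_sum_frame hx l i, hz, LinearMap.zero_apply]
    simp [hl]
  exact (LinearMap.injective_iff_surjective_of_finrank_eq_finrank
    (Subspace.dual_finrank_eq (K := ℝ) (V := A)).symm).mp hinj f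

theorem apply_self (hB : S.IsSpectralForm N B) {w : A} (hw : S.IsPure w) : B w w = 1 := by
  simpa using hB.frame (isFrame_singleton hw) 0 0

/-- In a diagonalising frame `B z z` is the sum of the squared coefficients, so `B` is positive
definite despite the subtraction in its construction. -/
theorem eq_zero_of_apply_self_nonpos (hB : S.IsSpectralForm N B) {z : A} (hz : B z z ≤ 0) :
    z = 0 := by
  obtain ⟨x, l, hx, rfl⟩ := hB.spectral z
  have h1 : B (∑ j, l j • x j) (∑ j, l j • x j) = ∑ j, l j ^ 2 := by
    conv_lhs => rw [map_sum]
    exact Finset.sum_congr rfl fun i _ => by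
      rw [map_smul, hB.apply_sum_frame hx, smul_eq_mul, sq]
  rw [h1] at hz
  have h2 := (Finset.sum_eq_zero_iff_of_nonneg fun j _ => sq_nonneg (l j)).mp
    (le_antisymm hz (Finset.sum_nonneg fun j _ => sq_nonneg (l j)))
  refine Finset.sum_eq_zero fun j hj => ?_
  rw [pow_eq_zero_iff two_ne_zero |>.mp (h2 j hj), zero_smul]

/-- The functional represented by a pure state is an allowed effect. -/
theorem pure_mem_allowed (hB : S.IsSpectralForm N B) {w : A} (hw : S.IsPure w) :
    (B w).toContinuousLinearMap ∈ S.allowed := by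
  obtain ⟨hN, x, hx, hxw⟩ := hB.maxFrame 1 _ (isFrame_singleton hw)
  set i₀ : Fin N := Fin.castLE hN 0
  replace hxw : x i₀ = w := hxw 0
  obtain ⟨e, he, -, hδ⟩ := hx.2.2
  -- The vector representing the distinguishing effect is `w` itself. Its coefficients in a
  -- diagonalising frame form a probability distribution, so `B z z ≤ 1`; with `B z w = B w w = 1`
  -- this gives `B (z - w) (z - w) ≤ 0`.
  obtain ⟨z, hz⟩ := hB.exists_representation (e i₀ : A →ₗ[ℝ] ℝ)
  replace hz : ∀ y, B z y = e i₀ y := fun y => LinearMap.congr_fun hz y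
  have huz : S.u z = 1 := by
    rw [← hB.sum_eq_u hx z]
    simp [hB.symm _ z, hz, hδ]
  have hzz : B z z ≤ 1 := by
    obtain ⟨y, l, hy, hzl⟩ := hB.spectral z
    have hl : ∀ j, B z (y j) = l j := fun j => by rw [hzl, hB.apply_sum_frame hy]
    have hl0 : ∀ j, 0 ≤ l j := fun j => by
      rw [← hl, hz]
      exact allowed_nonneg (he i₀) (hy.1 j).1
    have hsum : ∑ j, l j = 1 := by
      rw [← huz, hzl, map_sum]
      exact Finset.sum_congr rfl fun j _ => by simp [u_of_mem (hy.1 j).1]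
    have hl1 : ∀ j, l j ≤ 1 := fun j => by
      rw [← hsum]
      exact Finset.single_le_sum (fun i _ => hl0 i) (Finset.mem_univ j)
    calc B z z = ∑ j, l j * l j := by
          conv_lhs => arg 2; rw [hzl]
          rw [map_sum]
          exact Finset.sum_congr rfl fun j _ => by rw [map_smul, hl, smul_eq_mul]
      _ ≤ ∑ j, l j := Finset.sum_le_sum fun j _ => mul_le_of_le_one_right (hl0 j) (hl1 j)
      _ = 1 := hsum
  have hzw : B z w = 1 := by
    rw [hz, ← hxw, hδ, if_pos rfl]
  have hzeq : z - w = 0 := hB.eq_zero_of_apply_self_nonpos <| by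
    simp only [map_sub, LinearMap.sub_apply, hB.symm w z, hzw, hB.apply_self hw]
    linarith
  rw [sub_eq_zero] at hzeq
  have : (B w).toContinuousLinearMap = e i₀ := by
    ext y
    rw [← hzeq]
    exact hz y
  rw [this]
  exact he i₀

theorem pure_nonneg (hB : S.IsSpectralForm N B) {w x : A} (hw : S.IsPure w) (hx : x ∈ S.Ω) :
    0 ≤ B w x := allowed_nonneg (hB.pure_mem_allowed hw) hx

/-- An extension to a maximal frame adds only nonnegative terms, and there the sum equals `u`. -/
theorem frame_sum_le (hB : S.IsSpectralForm N B) {n : ℕ} {w : Fin n → A} (hw : S.IsFrame w)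
    {y : A} (hy : y ∈ S.Ω) : ∑ j, B (w j) y ≤ S.u y := by
  obtain ⟨h, x, hx, hxw⟩ := hB.maxFrame n w hw
  rw [← hB.sum_eq_u hx, Finset.sum_congr rfl fun j _ => by rw [← hxw j],
    ← Finset.sum_image (f := fun i => B (x i) y) (g := Fin.castLE h) (Fin.castLE_injective h).injOn]
  exact Finset.sum_le_sum_of_subset_of_nonneg (Finset.subset_univ _) fun i _ _ =>
    hB.pure_nonneg (hx.1 i) hy

/-- Pairwise orthogonal pure states are perfectly distinguishable. -/
theorem isFrame_of_pairwise (hB : S.IsSpectralForm N B) : ∀ {n : ℕ} {w : Fin n → A},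
    (∀ j, S.IsPure (w j)) → Pairwise (fun i j => B (w i) (w j) = 0) → S.IsFrame w
  | 0, w, hw, _ => ⟨hw, fun j => j.elim0, Fin.elim0, fun j => j.elim0,
      fun x hx => by simp [u_of_mem hx], fun j => j.elim0⟩
  | n + 1, w, hw, horth => by
    have ih : S.IsFrame fun j : Fin n => w j.castSucc := hB.isFrame_of_pairwise (fun j => hw _)
      fun i j hij => horth fun h => hij (Fin.castSucc_injective n h)
    let g : Fin n → A →L[ℝ] ℝ := fun j => (B (w j.castSucc)).toContinuousLinearMap
    have hg : ∀ j, g j ∈ S.allowed := fun j => hB.pure_mem_allowed (hw _)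
    have hsum : ∑ j, g j ∈ S.allowed := sum_mem_allowed _ (fun j _ => hg j) fun x hx =>
      hB.frame_sum_le ih hx
    have hgw : ∀ j k, g j (w k) = if j.castSucc = k then 1 else 0 := fun j k => by
      split_ifs with h
      · rw [← h]
        exact hB.apply_self (hw _)
      · exact horth h
    -- The last state is detected by the complement of the others; that complement is allowed
    -- because the first `n` states already form a frame.
    refine ⟨hw, fun j => (hw j).1, Fin.lastCases (S.u - ∑ j, g j) g, fun j => ?_, fun x _ => ?_,
      fun j k => ?_⟩
    · refine Fin.lastCases ?_ (fun j => ?_) j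
      · simpa using S.allowed_compl _ hsum
      · simpa using hg j
    · simp [Fin.sum_univ_castSucc]
    · refine Fin.lastCases ?_ (fun j => ?_) j
      · refine Fin.lastCases ?_ (fun k => ?_) k
        · simp [hgw, u_of_mem (hw _).1, Fin.castSucc_ne_last]
        · simp [hgw, u_of_mem (hw _).1, (Fin.castSucc_ne_last k).symm]
      · simp [hgw]

theorem sum_le_u_of_pairwise (hB : S.IsSpectralForm N B) {ι : Type*} [Fintype ι] {w : ι → A}
    (hw : ∀ j, S.IsPure (w j)) (horth : Pairwise fun i j => B (w i) (w j) = 0) {y : A}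
    (hy : y ∈ S.Ω) : ∑ j, B (w j) y ≤ S.u y := by
  let σ := (Fintype.equivFin ι).symm
  have hframe : S.IsFrame (w ∘ σ) := hB.isFrame_of_pairwise (fun j => hw _) fun i j hij =>
    horth (σ.injective.ne hij)
  rw [← Equiv.sum_comp σ]
  exact hB.frame_sum_le hframe hy

theorem pairwise_sumElim (hB : S.IsSpectralForm N B) {ι κ : Type*} {w : ι → A} {v : κ → A}
    (hw : Pairwise fun i j => B (w i) (w j) = 0) (hv : Pairwise fun i j => B (v i) (v j) = 0)
    (hwv : ∀ i j, B (w i) (v j) = 0) :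
    Pairwise fun i j => B (Sum.elim w v i) (Sum.elim w v j) = 0 := by
  rintro (i | i) (j | j) hij
  · exact hw fun h => hij (congrArg _ h)
  · exact hwv i j
  · exact (hB.symm _ _).trans (hwv j i)
  · exact hv fun h => hij (congrArg _ h)

/-- An allowed effect which is certain on pairwise orthogonal pure states dominates the sum of the
effects they represent. -/
theorem sum_le_of_apply_eq_one (hB : S.IsSpectralForm N B) {ι : Type*} [Fintype ι] {w : ι → A}
    (hw : ∀ j, S.IsPure (w j)) (horth : Pairwise fun i j => B (w i) (w j) = 0)
    {f : A →L[ℝ] ℝ} (hf : f ∈ S.allowed) (hfw : ∀ j, f (w j) = 1) {y : A} (hy : y ∈ S.Ω) :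
    ∑ j, B (w j) y ≤ f y := by
  obtain ⟨z, hz⟩ := hB.exists_representation (S.u - f : A →L[ℝ] ℝ)
  replace hz : ∀ y, B z y = S.u y - f y := fun y => LinearMap.congr_fun hz y
  obtain ⟨x, l, hx, hzl⟩ := hB.spectral z
  have hl : ∀ i, l i = S.u (x i) - f (x i) := fun i => by
    rw [← hz, hzl, hB.apply_sum_frame hx]
  have hl0 : ∀ i, 0 ≤ l i := fun i => by
    rw [hl, sub_nonneg]
    exact allowed_le_u hf (hx.1 i).1
  have hl1 : ∀ i, l i ≤ 1 := fun i => by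
    have := allowed_nonneg hf (hx.1 i).1
    rw [hl, u_of_mem (hx.1 i).1]
    linarith
  have hexp : ∀ y, S.u y - f y = ∑ i, l i * B (x i) y := fun y => by
    rw [← hz, hzl]
    simp
  -- Since `u - f` vanishes at each `w j`, the eigenstates of `u - f` with nonzero eigenvalue are
  -- orthogonal to the `w j`. Eigenvalues are at most 1, so `u - f` is below the sum over `κ`, and
  -- the two families together sum to at most `u`.
  let κ := {i : Fin N // l i ≠ 0}
  have horth' : ∀ (i : κ) j, B (x i) (w j) = 0 := fun i j => by
    have h1 := hexp (w j)
    rw [hfw, u_of_mem (hw j).1, sub_self] at h1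
    have h2 := (Finset.sum_eq_zero_iff_of_nonneg fun i _ =>
      mul_nonneg (hl0 i) (hB.pure_nonneg (hx.1 i) (hw j).1)).mp h1.symm i (Finset.mem_univ _)
    exact (mul_eq_zero.mp h2).resolve_left i.2
  have hle := hB.sum_le_u_of_pairwise (w := Sum.elim (fun i : κ => x i) w)
    (by rintro (i | j); exacts [hx.1 _, hw _])
    (hB.pairwise_sumElim (fun i j hij => by
      beta_reduce
      rw [hB.frame hx, if_neg fun h => hij (Subtype.ext h)]) horth horth') hy
  simp only [Fintype.sum_sum_type, Sum.elim_inl, Sum.elim_inr] at hle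
  have h3 : S.u y - f y ≤ ∑ i : κ, B (x i) y := by
    rw [hexp, ← Fintype.sum_of_injective (Subtype.val : κ → Fin N) Subtype.val_injective
      (fun i => l i * B (x i) y) _ (fun i hi => ?_) fun _ => rfl]
    · exact Finset.sum_le_sum fun i _ =>
        mul_le_of_le_one_left (hB.pure_nonneg (hx.1 i) hy) (hl1 i)
    · have h0 : l i = 0 := by
        by_contra h
        exact hi ⟨⟨i, h⟩, rfl⟩
      rw [h0, zero_mul]
  linarith

/-- Every set of states is carried by pairwise orthogonal pure states: these resolve the order unit
on the set, and every allowed effect which is certain on the set is certain on them. -/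
theorem exists_support (hB : S.IsSpectralForm N B) (h1 : S.ClassicalDecomposability) {F : Set A}
    (hF : F ⊆ S.Ω) : ∃ (ι : Type) (_ : Fintype ι) (w : ι → A), (∀ j, S.IsPure (w j)) ∧
      Pairwise (fun i j => B (w i) (w j) = 0) ∧ (∀ x ∈ F, ∑ j, B (w j) x = 1) ∧
      ∀ f ∈ S.allowed, (∀ x ∈ F, f x = 1) → ∀ j, f (w j) = 1 := by
  classical
  -- The support is read off a single state, the barycentre `b` of a finite spanning subset of `F`.
  -- An effect certain on `b` is certain on each component of positive weight, and `u` and linearity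
  -- pass from `t` to all of `F`.
  obtain ⟨t, htF, -, htspan, -⟩ := Submodule.exists_finset_span_eq_linearIndepOn ℝ F
  rcases t.eq_empty_or_nonempty with rfl | htne
  · refine ⟨Empty, inferInstance, Empty.elim, fun j => j.elim, fun j => j.elim, fun x hx => ?_,
      fun f _ _ j => j.elim⟩
    have h0 : x ∈ Submodule.span ℝ F := Submodule.subset_span hx
    rw [← htspan] at h0
    simp only [Finset.coe_empty, Submodule.span_empty, Submodule.mem_bot] at h0
    exact (ne_zero_of_mem (hF hx) h0).elim
  have hcard : 0 < (t.card : ℝ)⁻¹ := by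
    have := htne.card_pos
    positivity
  have hcard1 : ∑ _x ∈ t, (t.card : ℝ)⁻¹ = 1 := by
    rw [Finset.sum_const, nsmul_eq_mul, mul_inv_cancel₀ (inv_pos.mp hcard).ne']
  set b : A := ∑ x ∈ t, (t.card : ℝ)⁻¹ • x with hb
  have hbΩ : b ∈ S.Ω := S.convex_Ω.sum_mem (fun _ _ => hcard.le) hcard1 fun x hx => hF (htF hx)
  obtain ⟨n, p, v, hv, hp, hps, hbv⟩ := exists_isFrame_decomposition h1 hbΩ
  let ι := {j : Fin n // p j ≠ 0}
  have horth : Pairwise fun i j : ι => B (v i) (v j) = 0 := fun i j hij => by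
    beta_reduce
    rw [hB.frame hv, if_neg fun h => hij (Subtype.ext h)]
  have hle : ∀ x ∈ S.Ω, ∑ j : ι, B (v j) x ≤ 1 := fun x hx => by
    rw [← u_of_mem hx]
    exact hB.sum_le_u_of_pairwise (w := fun j : ι => v j) (fun j => hv.1 _) horth hx
  refine ⟨ι, inferInstance, fun j => v j, fun j => hv.1 _, horth, ?_, ?_⟩
  · let g : A →ₗ[ℝ] ℝ := ∑ j : ι, B (v j)
    have hg : ∀ x, g x = ∑ j : ι, B (v j) x := fun x => by simp [g]
    have hgv : ∀ k, p k * g (v k) = p k := fun k => by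
      by_cases hk : p k = 0
      · rw [hk, zero_mul]
      · rw [hg, Finset.sum_eq_single (⟨k, hk⟩ : ι), hB.frame hv, if_pos rfl, mul_one]
        · intro i _ hi
          rw [hB.frame hv, if_neg fun h => hi (Subtype.ext h)]
        · simp
    have hgb : g b = 1 := by
      rw [hbv, map_sum, ← hps]
      exact Finset.sum_congr rfl fun k _ => by rw [map_smul, smul_eq_mul, hgv]
    have hgt : ∀ x ∈ t, g x = 1 := by
      have h2 : ∑ x ∈ t, (t.card : ℝ)⁻¹ * g x = ∑ _x ∈ t, (t.card : ℝ)⁻¹ := by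
        rw [hcard1, ← hgb, hb, map_sum]
        simp
      have h3 := (Finset.sum_eq_sum_iff_of_le fun x hx => mul_le_of_le_one_right hcard.le
        ((hg x).trans_le (hle x (hF (htF hx))))).mp h2
      exact fun x hx => (mul_eq_left₀ hcard.ne').mp (h3 x hx)
    intro x hx
    have h4 : x ∈ Submodule.span ℝ (t : Set A) := htspan ▸ Submodule.subset_span hx
    have h5 : Set.EqOn g (S.u : A →ₗ[ℝ] ℝ) (Submodule.span ℝ (t : Set A)) :=
      LinearMap.eqOn_span' fun y hy => (hgt y hy).trans (u_of_mem (hF (htF hy))).symm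
    rw [← hg, h5 h4]
    exact u_of_mem (hF hx)
  · intro f hf hfF j
    have hfb : f b = 1 := by
      rw [hb, map_sum, ← hcard1]
      exact Finset.sum_congr rfl fun x hx => by rw [map_smul, hfF x (htF hx), smul_eq_mul, mul_one]
    have h2 : ∑ k, p k * f (v k) = ∑ k, p k := by
      rw [hps, ← hfb, hbv, map_sum]
      simp
    have h3 := (Finset.sum_eq_sum_iff_of_le fun k _ => mul_le_of_le_one_right (hp k)
      ((allowed_le_u hf (hv.1 k).1).trans_eq (u_of_mem (hv.1 k).1))).mp h2
    exact (mul_eq_left₀ j.2).mp (h3 j (Finset.mem_univ _))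

end IsSpectralForm

end GPT

/-! ### The state discrimination principle. -/

theorem mainTheorem12 {A : Type*} [NormedAddCommGroup A] [NormedSpace ℝ A] [FiniteDimensional ℝ A]
    (S : GPT A) (h1 : S.ClassicalDecomposability) (h2 : S.StrongSymmetry)
    (B₁ B₂ B₃ B₄ : Set A) (hB₁ : B₁ ⊆ S.Ω) (hB₂ : B₂ ⊆ S.Ω)
    (h12 : S.PerfectlyDistinguishableSets ![B₁, B₂])
    (hB₃ : B₃ ⊆ B₂) (hB₄ : B₄ ⊆ B₂)
    (h34 : S.PerfectlyDistinguishableSets ![B₃, B₄]) :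
    S.PerfectlyDistinguishableSets ![B₁, B₃, B₄] := by
  obtain ⟨N, Q, hQ⟩ := GPT.exists_isSpectralForm h1 h2
  obtain ⟨e, he, hele, heδ⟩ := h12
  obtain ⟨f, hf, hfle, hfδ⟩ := h34
  replace hele : ∀ x ∈ S.Ω, e 0 x + e 1 x ≤ S.u x := fun x hx => by
    simpa [Fin.sum_univ_two] using hele x hx
  replace hfle : ∀ x ∈ S.Ω, f 0 x + f 1 x ≤ S.u x := fun x hx => by
    simpa [Fin.sum_univ_two] using hfle x hx
  have he01 : ∀ x ∈ B₁, e 0 x = 1 := fun x hx => by simpa using heδ 0 0 x hx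
  have he10 : ∀ x ∈ B₁, e 1 x = 0 := fun x hx => by simpa using heδ 1 0 x hx
  have he02 : ∀ x ∈ B₂, e 0 x = 0 := fun x hx => by simpa using heδ 0 1 x hx
  have he12 : ∀ x ∈ B₂, e 1 x = 1 := fun x hx => by simpa using heδ 1 1 x hx
  have hf03 : ∀ x ∈ B₃, f 0 x = 1 := fun x hx => by simpa using hfδ 0 0 x hx
  have hf14 : ∀ x ∈ B₄, f 1 x = 1 := fun x hx => by simpa using hfδ 1 1 x hx
  obtain ⟨ι, _, w, hw, hworth, hw3, hwcert⟩ := hQ.exists_support h1 (hB₃.trans hB₂)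
  obtain ⟨κ, _, v, hv, hvorth, hv4, hvcert⟩ := hQ.exists_support h1 (hB₄.trans hB₂)
  have hew := hwcert _ (he 1) fun x hx => he12 x (hB₃ hx)
  have hev := hvcert _ (he 1) fun x hx => he12 x (hB₄ hx)
  have hfw := hwcert _ (hf 0) hf03
  have hfv := hvcert _ (hf 1) hf14
  -- The effect `f 1` dominates the sum over `v`, yet vanishes at `w i` because `f 0` is already
  -- certain there.
  have hvw : ∀ j i, Q (v j) (w i) = 0 := fun j i => by
    have h3 := hQ.sum_le_of_apply_eq_one hv hvorth (hf 1) hfv (hw i).1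
    have h4 := hfle _ (hw i).1
    rw [hfw, GPT.u_of_mem (hw i).1] at h4
    have h5 := Finset.single_le_sum (fun j _ => hQ.pure_nonneg (hv j) (hw i).1)
      (Finset.mem_univ j)
    exact le_antisymm (by linarith) (hQ.pure_nonneg (hv j) (hw i).1)
  let g₃ : A →L[ℝ] ℝ := ∑ i, (Q (w i)).toContinuousLinearMap
  let g₄ : A →L[ℝ] ℝ := ∑ j, (Q (v j)).toContinuousLinearMap
  have hg₃ : ∀ x, g₃ x = ∑ i, Q (w i) x := fun x => by simp [g₃]
  have hg₄ : ∀ x, g₄ x = ∑ j, Q (v j) x := fun x => by simp [g₄]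
  have hg₃mem : g₃ ∈ S.allowed := GPT.sum_mem_allowed _ (fun i _ => hQ.pure_mem_allowed (hw i))
    fun x hx => hQ.sum_le_u_of_pairwise hw hworth hx
  have hg₄mem : g₄ ∈ S.allowed := GPT.sum_mem_allowed _ (fun j _ => hQ.pure_mem_allowed (hv j))
    fun x hx => hQ.sum_le_u_of_pairwise hv hvorth hx
  -- Both supports lie where `e 1` is certain, and together they are one orthogonal family.
  have hle : ∀ x ∈ S.Ω, g₃ x + g₄ x ≤ e 1 x := fun x hx => by
    have := hQ.sum_le_of_apply_eq_one (w := Sum.elim w v)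
      (by rintro (i | j); exacts [hw i, hv j])
      (hQ.pairwise_sumElim hworth hvorth fun i j => (hQ.symm _ _).trans (hvw j i)) (he 1)
      (by rintro (i | j); exacts [hew i, hev j]) hx
    rw [hg₃, hg₄]
    simpa [Fintype.sum_sum_type] using this
  have hpos₃ : ∀ x ∈ S.Ω, 0 ≤ g₃ x := fun x hx => GPT.allowed_nonneg hg₃mem hx
  have hpos₄ : ∀ x ∈ S.Ω, 0 ≤ g₄ x := fun x hx => GPT.allowed_nonneg hg₄mem hx
  have hg₃₃ : ∀ x ∈ B₃, g₃ x = 1 := fun x hx => (hg₃ x).trans (hw3 x hx)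
  have hg₄₄ : ∀ x ∈ B₄, g₄ x = 1 := fun x hx => (hg₄ x).trans (hv4 x hx)
  have on₁ : ∀ x ∈ B₁, g₃ x = 0 ∧ g₄ x = 0 := fun x hx => by
    have h3 := hle x (hB₁ hx)
    rw [he10 x hx] at h3
    have h4 := hpos₃ x (hB₁ hx)
    have h5 := hpos₄ x (hB₁ hx)
    constructor <;> linarith
  have on₃ : ∀ x ∈ B₃, g₄ x = 0 := fun x hx => by
    have h3 := hle x (hB₂ (hB₃ hx))
    rw [he12 x (hB₃ hx), hg₃₃ x hx] at h3
    exact le_antisymm (by linarith) (hpos₄ x (hB₂ (hB₃ hx)))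
  have on₄ : ∀ x ∈ B₄, g₃ x = 0 := fun x hx => by
    have h3 := hle x (hB₂ (hB₄ hx))
    rw [he12 x (hB₄ hx), hg₄₄ x hx] at h3
    exact le_antisymm (by linarith) (hpos₃ x (hB₂ (hB₄ hx)))
  refine ⟨![e 0, g₃, g₄], ?_, fun x hx => ?_, ?_⟩
  · intro j
    fin_cases j
    exacts [he 0, hg₃mem, hg₄mem]
  · have h3 := hle x hx
    have h4 := hele x hx
    simp only [Fin.sum_univ_three, add_apply, Matrix.cons_val]
    linarith
  · intro j k x hx
    fin_cases k <;> fin_cases j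
    exacts [he01 x hx, (on₁ x hx).1, (on₁ x hx).2, he02 x (hB₃ hx), hg₃₃ x hx, on₃ x hx,
      he02 x (hB₄ hx), on₄ x hx, hg₄₄ x hx]
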